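/- Let $n\ge 1$. For $f:(0,\infty)^n\to\mathbb{R}$ and $x\in(0,\infty)^n$ write $\widehat f(x)=\int_{(0,\infty)^n} f(s)\,e^{-s\cdot x}\,ds$, and let $\mathcal{L}$ be the real vector space of functions $f:(0,\infty)^n\to\mathbb{R}$ (identified when they agree almost everywhere) for which $s\mapsto f(s)e^{-s\cdot x}$ is Lebesgue integrable on $(0,\infty)^n$ for every $x\in(0,\infty)^n$. For $T\in(0,\infty)^n$ let $(0,T)=(0,T_1)\times\cdots\times(0,T_n)$. For $\alpha\in[0,\infty)^n$ let $I^\alpha$ be the multidimensional Riemann--Liouville integral with left origin at $(0,\ldots,0)$, which integrates $\alpha_i$ times with respect to the $i$th coordinate: $I^\alpha f(t)=\int (f\mathbf{1}_{(0,\infty)^n})(t-s)\,d\mu_{\alpha_1}(s_1)\cdots d\mu_{\alpha_n}(s_n)$ for almost every $t\in(0,\infty)^n$, where $d\mu_a(s)=\mathbf{1}_{(0,\infty)}(s)\,\frac{s^{a-1}}{\Gamma(a)}\,ds$ if $a>0$ and $\mu_0=\delta_0$ is the Dirac measure at $0$. Let $(J^\alpha)_{\alpha\in[0,\infty)^n}$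 be a family of linear operators $J^\alpha:\mathcal{L}\to\mathcal{L}$, each continuous for $\|\cdot\|_{L^1(0,T)}$ for every $T\in(0,\infty)^n$ (that is, for each $\alpha$ and each $T$, $\|J^\alpha f_1-J^\alpha f_2\|_{L^1(0,T)}\to0$ when $f_1,f_2\in\mathcal{L}$ and $\|f_1-f_2\|_{L^1(0,T)}\to0$). Suppose: - Identity: for all $i\in\{1,\ldots,n\}$, $J^{e_i}=I^{e_i}$ on $\mathcal{L}$, where $e_i$ is the $i$th canonical vector of $\mathbb{R}^n$; - Index law: $J^{\alpha+\beta}=J^\alpha\circ J^\beta$ on $\mathcal{L}$ for all $\alpha,\beta\in[0,\infty)^n$; - Continuity: for every $x\in(0,\infty)^n$, the map $\alpha\mapsto\widehat{J^\alpha 1}(x)$ from $(0,\infty)^n$ to $\mathbb{R}$ is continuous at at least one point (which may depend on $x$). Then $J^\alpha=I^\alpha$ on $\mathcal{L}$ for all $\alpha\in[0,\infty)^n$. -/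

import Mathlib

open MeasureTheory
open scoped NNReal ENNReal

namespace FracCalc

noncomputable section

/-- The open orthant `(0,∞)ⁿ`. -/
def orthant (n : ℕ) : Set (Fin n → ℝ) := {t | ∀ i, 0 < t i}

/-- The open box `(0,T) = (0,T₁) × ⋯ × (0,Tₙ)`. -/
def box {n : ℕ} (T : Fin n → ℝ) : Set (Fin n → ℝ) := Set.univ.pi fun i => Set.Ioo 0 (T i)

/-- Lebesgue measure on `(0,∞)ⁿ`. -/
def orthantMeasure (n : ℕ) : Measure (Fin n → ℝ) := volume.restrict (orthant n)

/-- The Laplace kernel `e^{-s·x}`. -/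
def laplaceKernel {n : ℕ} (x s : Fin n → ℝ) : ℝ := Real.exp (-∑ i, s i * x i)

/-- The Laplace transform `f̂(x) = ∫_{(0,∞)ⁿ} f(s) e^{-s·x} ds`. -/
def laplace {n : ℕ} (f : (Fin n → ℝ) → ℝ) (x : Fin n → ℝ) : ℝ :=
  ∫ s, f s * laplaceKernel x s ∂(orthantMeasure n)

/-- `f` is Laplace transformable: the Lebesgue integral defining `f̂(x)` exists for all
`x ∈ (0,∞)ⁿ`. -/
def IsLaplaceTransformable {n : ℕ} (f : (Fin n → ℝ) → ℝ) : Prop :=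
  ∀ x ∈ orthant n, Integrable (fun s => f s * laplaceKernel x s) (orthantMeasure n)

/-- The space `𝓛` of Laplace transformable functions `(0,∞)ⁿ → ℝ`, functions that agree almost
everywhere being identified. -/
def LaplaceSpace (n : ℕ) : Submodule ℝ ((Fin n → ℝ) →ₘ[orthantMeasure n] ℝ) where
  carrier := {f | IsLaplaceTransformable f}
  zero_mem' := by
    intro x _
    refine (integrable_zero _ ℝ _).congr ?_
    filter_upwards [AEEqFun.coeFn_zero (μ := orthantMeasure n) (β := ℝ)] with s hs
    simp [hs]
  add_mem' := by
    intro f g hf hg x hx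
    refine ((hf x hx).add (hg x hx)).congr ?_
    filter_upwards [AEEqFun.coeFn_add f g] with s hs
    simp [hs, add_mul]
  smul_mem' := by
    intro c f hf x hx
    refine ((hf x hx).const_mul c).congr ?_
    filter_upwards [AEEqFun.coeFn_smul c f] with s hs
    simp [hs, mul_assoc]

instance {n : ℕ} : CoeFun (LaplaceSpace n) (fun _ => (Fin n → ℝ) → ℝ) := ⟨fun f => f.1⟩

theorem integrable_laplaceKernel {n : ℕ} {x : Fin n → ℝ} (hx : x ∈ orthant n) :
    Integrable (laplaceKernel x) (orthantMeasure n) := by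
  have h1 : orthantMeasure n = Measure.pi fun _ => (volume : Measure ℝ).restrict (Set.Ioi 0) := by
    rw [← Measure.restrict_pi_pi]
    unfold orthantMeasure
    congr 1
    ext t
    simp [orthant]
  have h2 : laplaceKernel x = fun s => ∏ i, Real.exp (-x i * s i) := by
    funext s
    rw [laplaceKernel, ← Real.exp_sum, ← Finset.sum_neg_distrib]
    congr 1
    exact Finset.sum_congr rfl fun i _ => by ring
  rw [h1, h2]
  exact Integrable.fintype_prod (f := fun i s => Real.exp (-x i * s))
    fun i => (integrableOn_exp_mul_Ioi (by simpa using hx i) 0)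

/-- The constant function `1`, as an element of `𝓛`. -/
def oneL (n : ℕ) : LaplaceSpace n :=
  ⟨AEEqFun.const (Fin n → ℝ) 1, by
    intro x hx
    refine (integrable_laplaceKernel hx).congr ?_
    filter_upwards [AEEqFun.coeFn_const (μ := orthantMeasure n) (Fin n → ℝ) (1 : ℝ)] with s hs
    simp [hs]⟩

/-- The norm of `L¹(0,T)`. -/
def boxNorm {n : ℕ} (T : Fin n → ℝ) (f : (Fin n → ℝ) → ℝ) : ℝ≥0∞ :=
  eLpNorm f 1 (volume.restrict (box T))

/-- `J : 𝓛 → 𝓛` is continuous for the norm of `L¹(0,T)`: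
`‖J f₁ - J f₂‖ → 0` when `‖f₁ - f₂‖ → 0`. -/
def IsBoxContinuous {n : ℕ} (T : Fin n → ℝ) (J : LaplaceSpace n → LaplaceSpace n) : Prop :=
  ∀ ε : ℝ≥0∞, 0 < ε → ∃ δ : ℝ≥0∞, 0 < δ ∧ ∀ f₁ f₂ : LaplaceSpace n,
    boxNorm T (f₁ - f₂ : LaplaceSpace n) < δ → boxNorm T (J f₁ - J f₂ : LaplaceSpace n) < ε

/-- The one-dimensional Riemann-Liouville kernel of order `a ≥ 0`, as a measure: it is
`s^{a-1}/Γ(a) ds` on `(0,∞)` if `a > 0`, and the Dirac delta `δ₀` if `a = 0`. -/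
def rlKernel (a : ℝ≥0) : Measure ℝ :=
  if a = 0 then Measure.dirac 0
  else (volume.restrict (Set.Ioi 0)).withDensity
    fun s => ENNReal.ofReal (s ^ ((a : ℝ) - 1) / Real.Gamma a)

instance (a : ℝ≥0) : SigmaFinite (rlKernel a) := by
  unfold rlKernel
  split_ifs <;> infer_instance

/-- The multidimensional Riemann-Liouville integral `I^α f` with left origin `(0,…,0)`, of
multi-order `α ∈ [0,∞)ⁿ`: the convolution of `f`, extended by zero outside `(0,∞)ⁿ`, with the
product of the one-dimensional kernels of orders `α₁, …, αₙ`. If all `αᵢ > 0`, this is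
`∫_{(0,t)} f(t - s) ∏ᵢ sᵢ^{αᵢ-1}/Γ(αᵢ) ds`; coordinates with `αᵢ = 0` are not integrated. -/
def rlIntegral {n : ℕ} (α : Fin n → ℝ≥0) (f : (Fin n → ℝ) → ℝ) (t : Fin n → ℝ) : ℝ :=
  ∫ s, (orthant n).indicator f (t - s) ∂(Measure.pi fun i => rlKernel (α i))

theorem measurableSet_orthant (n : ℕ) : MeasurableSet (orthant n) := by
  have : orthant n = Set.univ.pi fun _ => Set.Ioi 0 := by
    ext t
    simp [orthant]
  rw [this]
  exact MeasurableSet.univ_pi fun _ => measurableSet_Ioi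

/-- `I^α f` does not depend, up to a null set, on the representative of `f`. -/
theorem rlIntegral_congr_ae {n : ℕ} (α : Fin n → ℝ≥0) {f g : (Fin n → ℝ) → ℝ}
    (h : f =ᵐ[orthantMeasure n] g) : rlIntegral α f =ᵐ[volume] rlIntegral α g := by
  have h0 : (orthant n).indicator f =ᵐ[volume] (orthant n).indicator g := by
    have h1 := (ae_restrict_iff' (measurableSet_orthant n)).1 h
    filter_upwards [h1] with t ht
    by_cases hm : t ∈ orthant n
    · simp [hm, ht hm]
    · simp [hm]
  have h2 := (quasiMeasurePreserving_sub_of_right_invariant (volume : Measure (Fin n → ℝ))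
    (Measure.pi fun i => rlKernel (α i))).ae h0
  filter_upwards [Measure.ae_ae_of_ae_prod h2] with t ht
  exact integral_congr_ae ht

end

end FracCalc

open FracCalc

namespace FracCalc

open Filter Topology
open scoped BoundedContinuousFunction

/-! On the Laplace side `I^α` is multiplication by `∏ xᵢ^{-αᵢ}`, and the transform is injective
(`ae_eq_of_laplace_eq`), so it suffices to find the transform of `J^α f`.

The index law and `J^{eᵢ} = I^{eᵢ}` give the right multiplier for every integer order. The monomial
`s^k` is `k! J^k 1`, and `J^α` commutes with `J^k`, so on polynomials `J^α` is multiplication by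
`φ(α) = (∏ xᵢ) (J^α 1)^(x)` (`exists_coe_eq_mvPolynomial`). Polynomials are dense in `L¹(0,T)`, and
continuity of `J^α` carries this formula to all of `𝓛` (`laplace_apply_of_mvPolynomial`).

For fixed `x`, the index law then makes `φ` multiplicative in `α`. It is positive, and the logarithm
of its ratio to `∏ xᵢ^{-αᵢ}` is additive, zero on the basis and continuous at one point, hence zero
(`additive_eq_zero`). -/

theorem laplaceKernel_pos {n : ℕ} (x s : Fin n → ℝ) : 0 < laplaceKernel x s := Real.exp_pos _

theorem continuous_laplaceKernel {n : ℕ} (x : Fin n → ℝ) : Continuous (laplaceKernel x) := by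
  unfold laplaceKernel
  fun_prop

theorem laplaceKernel_mul_sub {n : ℕ} (x s t : Fin n → ℝ) :
    laplaceKernel x s * laplaceKernel x (t - s) = laplaceKernel x t := by
  rw [laplaceKernel, laplaceKernel, laplaceKernel, ← Real.exp_add, ← neg_add,
    ← Finset.sum_add_distrib]
  congr 2
  refine Finset.sum_congr rfl fun i _ => ?_
  simp only [Pi.sub_apply]
  ring

theorem laplaceKernel_eq_prod {n : ℕ} (x s : Fin n → ℝ) :
    laplaceKernel x s = ∏ i, Real.exp (-(x i * s i)) := by
  rw [laplaceKernel, ← Real.exp_sum, ← Finset.sum_neg_distrib]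
  simp only [mul_comm]

theorem orthantMeasure_eq_pi (n : ℕ) :
    orthantMeasure n = Measure.pi fun _ => (volume : Measure ℝ).restrict (Set.Ioi 0) := by
  rw [← Measure.restrict_pi_pi]
  unfold orthantMeasure
  congr 1
  ext t
  simp [orthant]

instance (n : ℕ) : SigmaFinite (orthantMeasure n) := by
  unfold orthantMeasure
  infer_instance

theorem ae_orthantMeasure_mem (n : ℕ) : ∀ᵐ s ∂orthantMeasure n, s ∈ orthant n :=
  ae_restrict_mem (measurableSet_orthant n)

theorem IsLaplaceTransformable.aestronglyMeasurable {n : ℕ} {f : (Fin n → ℝ) → ℝ}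
    (hf : IsLaplaceTransformable f) : AEStronglyMeasurable f (orthantMeasure n) := by
  have h := (hf (fun _ => 1) fun _ => one_pos).aestronglyMeasurable
  have h2 : AEStronglyMeasurable (fun s => (laplaceKernel (fun _ : Fin n => (1 : ℝ)) s)⁻¹)
      (orthantMeasure n) :=
    ((continuous_laplaceKernel _).inv₀ fun s => (laplaceKernel_pos _ s).ne').aestronglyMeasurable
  refine (h.mul h2).congr (ae_of_all _ fun s => ?_)
  have := (laplaceKernel_pos (fun _ : Fin n => (1 : ℝ)) s).ne'
  simp only [Pi.mul_apply]
  field_simp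

theorem isLaplaceTransformable_coe {n : ℕ} (f : LaplaceSpace n) : IsLaplaceTransformable f := f.2

theorem laplace_congr_ae {n : ℕ} {f g : (Fin n → ℝ) → ℝ} (h : f =ᵐ[orthantMeasure n] g) :
    laplace f = laplace g := by
  funext x
  refine integral_congr_ae ?_
  filter_upwards [h] with s hs
  rw [hs]

/-! ### Convolution on the orthant and its Laplace transform. -/

/-- Convolution of a density `h` with respect to `ν` with a function on the orthant. -/
noncomputable def orthantConv {n : ℕ} (ν : Measure (Fin n → ℝ)) (h f : (Fin n → ℝ) → ℝ)
    (t : Fin n → ℝ) : ℝ :=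
  ∫ s, h s * (orthant n).indicator f (t - s) ∂ν

section Conv

variable {n : ℕ} {ν : Measure (Fin n → ℝ)} {h f : (Fin n → ℝ) → ℝ}

theorem indicator_mul_laplaceKernel (f : (Fin n → ℝ) → ℝ) (x s : Fin n → ℝ) :
    (orthant n).indicator (fun s => f s * laplaceKernel x s) s =
      (orthant n).indicator f s * laplaceKernel x s := by
  by_cases hs : s ∈ orthant n <;> simp [hs]

theorem orthantConv_integrand (x s t : Fin n → ℝ) :
    (h s * laplaceKernel x s) *
      (orthant n).indicator (fun s => f s * laplaceKernel x s) (t - s) =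
      laplaceKernel x t * (h s * (orthant n).indicator f (t - s)) := by
  rw [indicator_mul_laplaceKernel, ← laplaceKernel_mul_sub x s t]
  ring

theorem orthantConv_eq_zero (hν : ∀ᵐ s ∂ν, ∀ i, 0 ≤ s i) {t : Fin n → ℝ} (ht : t ∉ orthant n) :
    orthantConv ν h f t = 0 := by
  refine integral_eq_zero_of_ae ?_
  filter_upwards [hν] with s hs
  have : t - s ∉ orthant n := fun h => ht fun i => by
    have h1 := h i
    have h2 := hs i
    simp only [Pi.sub_apply] at h1
    linarith
  simp [this]

/-- The exponential is a character, so weighting both factors by it weights their convolution. This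
reduces `orthantConv` to the `L¹` theory of convolution. -/
theorem convolution_eq_orthantConv (x t : Fin n → ℝ) :
    convolution (fun s => h s * laplaceKernel x s)
      ((orthant n).indicator fun s => f s * laplaceKernel x s) (ContinuousLinearMap.mul ℝ ℝ) ν t =
      orthantConv ν h f t * laplaceKernel x t := by
  simp only [convolution_def, ContinuousLinearMap.mul_apply', orthantConv_integrand]
  rw [integral_const_mul, mul_comm, orthantConv]

theorem IsLaplaceTransformable.orthantConv [SFinite ν]
    (hh : ∀ x ∈ orthant n, Integrable (fun s => h s * laplaceKernel x s) ν)
    (hf : IsLaplaceTransformable f) : IsLaplaceTransformable (orthantConv ν h f) := by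
  intro x hx
  have h1 := ((hh x hx).convolution_integrand (ContinuousLinearMap.mul ℝ ℝ)
    ((integrable_indicator_iff (measurableSet_orthant n)).2 (hf x hx))).integral_prod_left
  exact (h1.congr (ae_of_all _ (convolution_eq_orthantConv x))).integrableOn

theorem laplace_orthantConv [SFinite ν] (hν : ∀ᵐ s ∂ν, ∀ i, 0 ≤ s i)
    (hh : ∀ x ∈ orthant n, Integrable (fun s => h s * laplaceKernel x s) ν)
    (hf : IsLaplaceTransformable f) {x : Fin n → ℝ} (hx : x ∈ orthant n) :
    laplace (FracCalc.orthantConv ν h f) x = (∫ s, h s * laplaceKernel x s ∂ν) * laplace f x := by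
  have h1 := integral_convolution (ContinuousLinearMap.mul ℝ ℝ) (hh x hx)
    ((integrable_indicator_iff (measurableSet_orthant n)).2 (hf x hx))
  simp only [convolution_eq_orthantConv, ContinuousLinearMap.mul_apply'] at h1
  rw [integral_indicator (measurableSet_orthant n)] at h1
  rw [laplace, laplace, orthantMeasure, ← h1]
  -- Since `ν` lives on nonnegative vectors, the convolution vanishes off the orthant, and Fubini on
  -- the whole space computes the transform.
  refine setIntegral_eq_integral_of_forall_compl_eq_zero fun t ht => ?_
  rw [orthantConv_eq_zero hν ht, zero_mul]

theorem ae_integrable_orthantConv_integrand [SFinite ν]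
    (hh : ∀ x ∈ orthant n, Integrable (fun s => h s * laplaceKernel x s) ν)
    (hf : IsLaplaceTransformable f) :
    ∀ᵐ t, Integrable (fun s => h s * (orthant n).indicator f (t - s)) ν := by
  have hx : (fun _ => 1) ∈ orthant n := fun _ => one_pos
  have h1 := (hh _ hx).ae_convolution_exists (ContinuousLinearMap.mul ℝ ℝ)
    ((integrable_indicator_iff (measurableSet_orthant n)).2 (hf _ hx))
  filter_upwards [h1] with t ht
  rw [ConvolutionExistsAt] at ht
  simp only [ContinuousLinearMap.mul_apply', orthantConv_integrand] at ht
  exact (integrable_const_mul_iff (laplaceKernel_pos _ t).ne'.isUnit _).1 ht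

end Conv

/-! ### Laplace transforms of Riemann-Liouville integrals and of monomials. -/

theorem integral_exp_rlKernel (a : ℝ≥0) {x : ℝ} (hx : 0 < x) :
    ∫ s, Real.exp (-(x * s)) ∂rlKernel a = x ^ (-(a : ℝ)) := by
  unfold rlKernel
  split_ifs with ha
  · simp [ha]
  · have ha' : 0 < (a : ℝ) := by positivity
    rw [integral_withDensity_eq_integral_toReal_smul (by fun_prop) (by simp)]
    have : ∀ s ∈ Set.Ioi (0 : ℝ), (ENNReal.ofReal (s ^ ((a : ℝ) - 1) / Real.Gamma a)).toReal •
        Real.exp (-(x * s)) =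
        (Real.Gamma a)⁻¹ * (s ^ ((a : ℝ) - 1) * Real.exp (-(x * s))) := by
      intro s hs
      rw [ENNReal.toReal_ofReal (div_nonneg (Real.rpow_nonneg hs.le _)
        (Real.Gamma_pos_of_pos ha').le)]
      simp only [smul_eq_mul]
      ring
    rw [setIntegral_congr_fun measurableSet_Ioi this, integral_const_mul,
      Real.integral_rpow_mul_exp_neg_mul_Ioi ha' hx, one_div, Real.inv_rpow hx.le,
      Real.rpow_neg hx.le]
    field_simp [(Real.Gamma_pos_of_pos ha').ne']

theorem ae_rlKernel_nonneg (a : ℝ≥0) : ∀ᵐ s ∂rlKernel a, 0 ≤ s := by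
  unfold rlKernel
  split_ifs with ha
  · simp
  · refine (withDensity_absolutelyContinuous _ _).ae_le ?_
    filter_upwards [ae_restrict_mem measurableSet_Ioi] with s hs using le_of_lt hs

section RL

variable {n : ℕ} (α : Fin n → ℝ≥0)

theorem ae_pi_rlKernel_nonneg : ∀ᵐ s ∂Measure.pi fun i => rlKernel (α i), ∀ i, 0 ≤ s i := by
  rw [ae_all_iff]
  intro i
  exact (Measure.tendsto_eval_ae_ae (μ := fun i => rlKernel (α i)) (i := i)).eventually
    (ae_rlKernel_nonneg (α i))

theorem integral_laplaceKernel_pi_rlKernel {x : Fin n → ℝ} (hx : x ∈ orthant n) :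
    ∫ s, laplaceKernel x s ∂(Measure.pi fun i => rlKernel (α i)) = ∏ i, x i ^ (-(α i : ℝ)) := by
  simp only [laplaceKernel_eq_prod]
  rw [integral_fintype_prod_eq_prod (fun i s => Real.exp (-(x i * s)))]
  exact Finset.prod_congr rfl fun i _ => integral_exp_rlKernel _ (hx i)

theorem integrable_laplaceKernel_pi_rlKernel {x : Fin n → ℝ} (hx : x ∈ orthant n) :
    Integrable (laplaceKernel x) (Measure.pi fun i => rlKernel (α i)) := by
  -- The integral of a non-integrable function is `0` by convention, so a nonzero value proves
  -- integrability.
  refine .of_integral_ne_zero ?_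
  rw [integral_laplaceKernel_pi_rlKernel α hx]
  exact (Finset.prod_pos fun i _ => Real.rpow_pos_of_pos (hx i) _).ne'

theorem rlIntegral_eq_orthantConv (f : (Fin n → ℝ) → ℝ) :
    rlIntegral α f = orthantConv (Measure.pi fun i => rlKernel (α i)) (fun _ => 1) f := by
  funext t
  simp [rlIntegral, orthantConv]

theorem IsLaplaceTransformable.rlIntegral {f : (Fin n → ℝ) → ℝ} (hf : IsLaplaceTransformable f) :
    IsLaplaceTransformable (rlIntegral α f) := by
  rw [rlIntegral_eq_orthantConv]
  refine hf.orthantConv fun x hx => ?_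
  simpa using integrable_laplaceKernel_pi_rlKernel α hx

theorem laplace_rlIntegral {f : (Fin n → ℝ) → ℝ} (hf : IsLaplaceTransformable f)
    {x : Fin n → ℝ} (hx : x ∈ orthant n) :
    laplace (FracCalc.rlIntegral α f) x = (∏ i, x i ^ (-(α i : ℝ))) * laplace f x := by
  rw [rlIntegral_eq_orthantConv, laplace_orthantConv (ae_pi_rlKernel_nonneg α) _ hf hx]
  · simp [integral_laplaceKernel_pi_rlKernel α hx]
  · intro x hx
    simpa using integrable_laplaceKernel_pi_rlKernel α hx

end RL

theorem laplace_monomial {n : ℕ} (k : Fin n → ℕ) {x : Fin n → ℝ}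
    (hx : x ∈ orthant n) :
    laplace (fun s => ∏ i, s i ^ k i) x = ∏ i, ((k i).factorial : ℝ) * (x i)⁻¹ ^ (k i + 1) := by
  have h : ∀ s : Fin n → ℝ, (∏ i, s i ^ k i) * laplaceKernel x s =
      ∏ i, s i ^ k i * Real.exp (-(x i * s i)) := fun s => by
    rw [laplaceKernel_eq_prod, Finset.prod_mul_distrib]
  simp only [laplace, h, orthantMeasure_eq_pi]
  rw [integral_fintype_prod_eq_prod (fun i s => s ^ k i * Real.exp (-(x i * s)))]
  refine Finset.prod_congr rfl fun i _ => ?_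
  have := Real.integral_rpow_mul_exp_neg_mul_Ioi (a := k i + 1) (by positivity) (hx i)
  simp only [add_sub_cancel_right, Real.rpow_natCast] at this
  rw [this, Real.Gamma_nat_eq_factorial, mul_comm, one_div]
  norm_cast

theorem isLaplaceTransformable_monomial {n : ℕ} (k : Fin n → ℕ) :
    IsLaplaceTransformable fun s : Fin n → ℝ => ∏ i, s i ^ k i := by
  intro x hx
  refine .of_integral_ne_zero ?_
  have := laplace_monomial k hx
  rw [laplace] at this
  rw [this]
  exact (Finset.prod_pos fun i _ => by have := hx i; positivity).ne'

/-! ### Injectivity of the Laplace transform. -/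

/-- A bounded, injective, continuous function on `ℝ` that is `e^{-s}` for `s ≥ 0`. -/
noncomputable def expExt (s : ℝ) : ℝ := if 0 ≤ s then Real.exp (-s) else 2 - Real.exp s

theorem continuous_expExt : Continuous expExt := by
  refine Continuous.if_le (by fun_prop) (by fun_prop) continuous_const continuous_id ?_
  rintro x rfl
  norm_num

theorem strictAnti_expExt : StrictAnti expExt := by
  intro s t hst
  unfold expExt
  split_ifs with h1 h2 h2
  · exact Real.exp_lt_exp.2 (by linarith)
  · have : Real.exp (-t) ≤ 1 := Real.exp_le_one_iff.2 (by linarith)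
    have : Real.exp s < 1 := Real.exp_lt_one_iff.2 (by linarith)
    linarith
  · linarith
  · have := Real.exp_lt_exp.2 hst
    linarith

theorem abs_expExt_le (s : ℝ) : |expExt s| ≤ 2 := by
  unfold expExt
  split_ifs with h
  · have : Real.exp (-s) ≤ 1 := Real.exp_le_one_iff.2 (by linarith)
    rw [abs_of_pos (Real.exp_pos _)]
    linarith
  · have : Real.exp s < 1 := Real.exp_lt_one_iff.2 (by linarith)
    have := Real.exp_pos s
    rw [abs_of_pos] <;> linarith

/-- The bounded continuous function `s ↦ expExt (s i)`. -/
noncomputable def expExtCoord {n : ℕ} (i : Fin n) : (Fin n → ℝ) →ᵇ ℝ :=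
  .ofNormedAddCommGroup (fun s => expExt (s i)) (continuous_expExt.comp (continuous_apply i)) 2
    fun s => abs_expExt_le (s i)

/-- The algebra of polynomials in the functions `expExtCoord i`. -/
noncomputable def expExtAlgebra (n : ℕ) : StarSubalgebra ℝ ((Fin n → ℝ) →ᵇ ℝ) where
  toSubalgebra := (MvPolynomial.aeval (R := ℝ) (expExtCoord (n := n))).range
  star_mem' := by
    intro a ha
    rwa [show star a = a from by ext; simp]

theorem aeval_expExtCoord_monomial {n : ℕ} (k : Fin n →₀ ℕ) (c : ℝ) {s : Fin n → ℝ}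
    (hs : s ∈ orthant n) :
    MvPolynomial.aeval (R := ℝ) (expExtCoord (n := n)) (MvPolynomial.monomial k c) s =
      c * laplaceKernel (fun i => k i) s := by
  rw [MvPolynomial.aeval_monomial, laplaceKernel_eq_prod, Finsupp.prod_fintype _ _ (by simp)]
  simp only [BoundedContinuousFunction.mul_apply, BoundedContinuousFunction.algebraMap_apply,
    smul_eq_mul, mul_one, BoundedContinuousFunction.coe_prod, Finset.prod_apply,
    BoundedContinuousFunction.coe_pow, Pi.pow_apply]
  congr 1
  refine Finset.prod_congr rfl fun i _ => ?_
  rw [show expExtCoord i s = Real.exp (-s i) from if_pos (hs i).le, ← Real.exp_nat_mul]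
  congr 1
  ring

theorem laplaceKernel_mul_add {n : ℕ} (x y s : Fin n → ℝ) :
    laplaceKernel x s * laplaceKernel y s = laplaceKernel (x + y) s := by
  rw [laplaceKernel, laplaceKernel, laplaceKernel, ← Real.exp_add, ← neg_add,
    ← Finset.sum_add_distrib]
  simp only [Pi.add_apply, mul_add]

/-- On the orthant a monomial in the `e^{-sᵢ}` is a Laplace kernel at an integer point `k`. The
weight shifts it to `1 + k`, which lies in the open orthant even when some `kᵢ = 0`. -/
theorem integral_mul_expExtAlgebra_eq_zero {n : ℕ} {f : (Fin n → ℝ) → ℝ}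
    (hf : IsLaplaceTransformable f) (h0 : ∀ x ∈ orthant n, laplace f x = 0)
    (p : MvPolynomial (Fin n) ℝ) :
    ∫ s, f s * laplaceKernel (fun _ => 1) s *
      MvPolynomial.aeval (R := ℝ) (expExtCoord (n := n)) p s ∂orthantMeasure n = 0 := by
  have hint := hf (fun _ => 1) fun _ => one_pos
  have hint' : ∀ g : (Fin n → ℝ) →ᵇ ℝ, Integrable
      (fun s => f s * laplaceKernel (fun _ => 1) s * g s) (orthantMeasure n) := fun g =>
    hint.mul_bdd g.continuous.aestronglyMeasurable (ae_of_all _ g.norm_coe_le_norm)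
  induction p using MvPolynomial.induction_on' with
  | monomial k c =>
    have hx : (fun i => 1 + (k i : ℝ)) ∈ orthant n := fun i => by positivity
    have : ∀ᵐ s ∂orthantMeasure n, f s * laplaceKernel (fun _ => 1) s *
        MvPolynomial.aeval (R := ℝ) (expExtCoord (n := n)) (MvPolynomial.monomial k c) s =
        c * (f s * laplaceKernel (fun i => 1 + (k i : ℝ)) s) := by
      filter_upwards [ae_orthantMeasure_mem n] with s hs
      rw [aeval_expExtCoord_monomial k c hs]
      have := laplaceKernel_mul_add (fun _ => 1) (fun i => (k i : ℝ)) s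
      rw [show (fun i => 1 + (k i : ℝ)) = (fun _ => 1) + fun i => (k i : ℝ) from rfl, ← this]
      ring
    rw [integral_congr_ae this, integral_const_mul]
    have := h0 _ hx
    rw [laplace] at this
    rw [this, mul_zero]
  | add p q hp hq =>
    simp only [map_add, BoundedContinuousFunction.add_apply, mul_add]
    rw [integral_add (hint' _) (hint' _), hp, hq, add_zero]

/-- The positive and negative parts of `f e^{-∑ sᵢ}` are densities of two finite measures with equal
integrals on a point-separating algebra of bounded continuous functions. Such measures on a Polish
space coincide. -/
theorem ae_eq_zero_of_laplace_eq_zero {n : ℕ} {f : (Fin n → ℝ) → ℝ}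
    (hf : IsLaplaceTransformable f) (h0 : ∀ x ∈ orthant n, laplace f x = 0) :
    f =ᵐ[orthantMeasure n] 0 := by
  set k1 := laplaceKernel (fun _ : Fin n => (1 : ℝ)) with hk1
  have hint : Integrable (fun s => f s * k1 s) (orthantMeasure n) :=
    hf (fun _ => 1) fun _ => one_pos
  have hneg : Integrable (fun s => -(f s * k1 s)) (orthantMeasure n) := hint.neg
  have hfin : ∀ g : (Fin n → ℝ) → ℝ, Integrable g (orthantMeasure n) →
      IsFiniteMeasure ((orthantMeasure n).withDensity fun s => ENNReal.ofReal (g s)) :=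
    fun g hg => isFiniteMeasure_withDensity_ofReal hg.2
  have := hfin _ hint
  have := hfin _ hneg
  have hae := hint.aestronglyMeasurable.aemeasurable
  have hae' := hneg.aestronglyMeasurable.aemeasurable
  have key : (orthantMeasure n).withDensity (fun s => ENNReal.ofReal (f s * k1 s)) =
      (orthantMeasure n).withDensity (fun s => ENNReal.ofReal (-(f s * k1 s))) := by
    refine ext_of_forall_mem_subalgebra_integral_eq_of_polish (𝕜 := ℝ) (A := expExtAlgebra n) ?_ ?_
    -- Points must be separated on all of `ℝⁿ`, not just on the orthant; this is why `expExt` is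
    -- injective on the whole line.
    · intro s t hst
      obtain ⟨i, hi⟩ := Function.ne_iff.1 hst
      refine ⟨expExtCoord i, ⟨_, ⟨expExtCoord i, ?_, rfl⟩, rfl⟩, strictAnti_expExt.injective.ne hi⟩
      exact ⟨MvPolynomial.X i, by simp⟩
    · rintro _ ⟨p, rfl⟩
      rw [integral_withDensity_eq_integral_toReal_smul₀ hae.ennreal_ofReal (by simp),
        integral_withDensity_eq_integral_toReal_smul₀ hae'.ennreal_ofReal (by simp),
        ← sub_eq_zero, ← integral_sub]
      · rw [← integral_mul_expExtAlgebra_eq_zero hf h0 p]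
        refine integral_congr_ae (ae_of_all _ fun s => ?_)
        simp only [smul_eq_mul, ← sub_mul, AlgHom.toRingHom_eq_coe, RingHom.coe_coe]
        congr 1
        rcases le_total 0 (f s * k1 s) with h | h
        · rw [ENNReal.toReal_ofReal h, ENNReal.ofReal_of_nonpos (by linarith)]
          simp [hk1]
        · rw [ENNReal.toReal_ofReal (by linarith : 0 ≤ -(f s * k1 s)), ENNReal.ofReal_of_nonpos h]
          simp [hk1]
      · refine Integrable.mul_bdd ?_ (BoundedContinuousFunction.continuous _).aestronglyMeasurable
          (ae_of_all _ (BoundedContinuousFunction.norm_coe_le_norm _))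
        exact integrable_toReal_of_lintegral_ne_top hae.ennreal_ofReal hint.lintegral_lt_top.ne
      · refine Integrable.mul_bdd ?_ (BoundedContinuousFunction.continuous _).aestronglyMeasurable
          (ae_of_all _ (BoundedContinuousFunction.norm_coe_le_norm _))
        exact integrable_toReal_of_lintegral_ne_top hae'.ennreal_ofReal
          hneg.lintegral_lt_top.ne
  rw [withDensity_eq_iff hae.ennreal_ofReal hae'.ennreal_ofReal hint.lintegral_lt_top.ne] at key
  filter_upwards [key] with s hs
  have hk : 0 < k1 s := laplaceKernel_pos _ _
  have h1 : f s * k1 s = 0 := by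
    rcases le_total 0 (f s * k1 s) with h | h
    · rw [ENNReal.ofReal_of_nonpos (by linarith : -(f s * k1 s) ≤ 0), ENNReal.ofReal_eq_zero] at hs
      exact le_antisymm hs h
    · rw [ENNReal.ofReal_of_nonpos h, eq_comm, ENNReal.ofReal_eq_zero] at hs
      linarith
  simpa [hk.ne'] using h1

theorem IsLaplaceTransformable.sub {n : ℕ} {f g : (Fin n → ℝ) → ℝ}
    (hf : IsLaplaceTransformable f) (hg : IsLaplaceTransformable g) :
    IsLaplaceTransformable (f - g) := by
  intro x hx
  simp only [Pi.sub_apply, sub_mul]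
  exact (hf x hx).sub (hg x hx)

theorem laplace_sub {n : ℕ} {f g : (Fin n → ℝ) → ℝ}
    (hf : IsLaplaceTransformable f) (hg : IsLaplaceTransformable g) {x : Fin n → ℝ}
    (hx : x ∈ orthant n) : laplace (f - g) x = laplace f x - laplace g x := by
  simp only [laplace, Pi.sub_apply, sub_mul]
  exact integral_sub (hf x hx) (hg x hx)

/-- The Laplace transform is injective. -/
theorem ae_eq_of_laplace_eq {n : ℕ} {f g : (Fin n → ℝ) → ℝ}
    (hf : IsLaplaceTransformable f) (hg : IsLaplaceTransformable g)
    (h : ∀ x ∈ orthant n, laplace f x = laplace g x) : f =ᵐ[orthantMeasure n] g := by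
  have := ae_eq_zero_of_laplace_eq_zero (hf.sub hg) fun x hx => by
    rw [laplace_sub hf hg hx, h x hx, sub_self]
  filter_upwards [this] with s hs
  simpa [sub_eq_zero] using hs

/-! ### Estimates in `L¹(0,T)` and density of polynomials. -/

section Box

variable {n : ℕ}

theorem box_subset_orthant (T : Fin n → ℝ) : box T ⊆ orthant n :=
  fun _ ht i => (ht i trivial).1

theorem measurableSet_box (T : Fin n → ℝ) : MeasurableSet (box T) :=
  MeasurableSet.univ_pi fun _ => measurableSet_Ioo

theorem restrict_box_le (T : Fin n → ℝ) : volume.restrict (box T) ≤ orthantMeasure n :=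
  Measure.restrict_mono (box_subset_orthant T) le_rfl

theorem boxNorm_congr_ae {T : Fin n → ℝ} {f g : (Fin n → ℝ) → ℝ}
    (h : f =ᵐ[orthantMeasure n] g) : boxNorm T f = boxNorm T g :=
  eLpNorm_congr_ae ((restrict_box_le T).absolutelyContinuous.ae_le h)

theorem boxNorm_coe_sub (T : Fin n → ℝ) (f g : LaplaceSpace n) :
    boxNorm T (f - g : LaplaceSpace n) = boxNorm T ((f : (Fin n → ℝ) → ℝ) - g) :=
  boxNorm_congr_ae (AEEqFun.coeFn_sub f.1 g.1)

theorem IsLaplaceTransformable.integrable_box {f : (Fin n → ℝ) → ℝ}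
    (hf : IsLaplaceTransformable f) (T : Fin n → ℝ) : Integrable f (volume.restrict (box T)) := by
  set k1 := laplaceKernel (fun _ : Fin n => (1 : ℝ)) with hk1
  have h1 : Integrable (fun s => f s * k1 s) (volume.restrict (box T)) :=
    (hf _ fun _ => one_pos).mono_measure (restrict_box_le T)
  have hk : Continuous fun s => (k1 s)⁻¹ :=
    (continuous_laplaceKernel _).inv₀ fun s => (laplaceKernel_pos _ s).ne'
  refine (h1.mul_bdd (c := Real.exp (∑ i, T i)) hk.aestronglyMeasurable ?_).congr
    (ae_of_all _ fun s => ?_)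
  · filter_upwards [ae_restrict_mem (measurableSet_box T)] with s hs
    rw [hk1, laplaceKernel, ← Real.exp_neg, neg_neg, Real.norm_of_nonneg (Real.exp_pos _).le]
    refine Real.exp_le_exp.2 (Finset.sum_le_sum fun i _ => ?_)
    rw [mul_one]
    exact (hs i trivial).2.le
  · have : k1 s ≠ 0 := (laplaceKernel_pos _ s).ne'
    field_simp

theorem IsLaplaceTransformable.boxNorm_ne_top {f : (Fin n → ℝ) → ℝ}
    (hf : IsLaplaceTransformable f) (T : Fin n → ℝ) : boxNorm T f ≠ ∞ :=
  (memLp_one_iff_integrable.2 (hf.integrable_box T)).eLpNorm_ne_top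

/-- Causality: if `s` and `t - s` have positive coordinates and `t` lies in the box, then so do both
of them. Only the restrictions of `h` and `f` to the box matter. -/
theorem enorm_orthantConv_le {T t : Fin n → ℝ} (ht : t ∈ box T) {h : (Fin n → ℝ) → ℝ} {C : ℝ≥0∞}
    (hC : C ≠ ∞) (hh : ∀ s ∈ box T, ‖h s‖ₑ ≤ C) (f : (Fin n → ℝ) → ℝ) :
    ‖orthantConv (orthantMeasure n) h f t‖ₑ ≤ C * boxNorm T f := by
  have key : ∀ s ∈ orthant n, ‖h s * (orthant n).indicator f (t - s)‖ₑ ≤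
      C * (box T).indicator (fun s => ‖f s‖ₑ) (t - s) := by
    intro s hs
    by_cases hts : t - s ∈ orthant n
    · have h1 : s ∈ box T := fun i _ => ⟨hs i, by
        have := hts i
        have := (ht i trivial).2
        simp only [Pi.sub_apply] at *
        linarith⟩
      have h2 : t - s ∈ box T := fun i _ => ⟨hts i, by
        have := hs i
        have := (ht i trivial).2
        simp only [Pi.sub_apply] at *
        linarith⟩
      rw [Set.indicator_of_mem hts, Set.indicator_of_mem h2, enorm_mul]
      gcongr
      exact hh s h1
    · simp [hts]
  calc ‖orthantConv (orthantMeasure n) h f t‖ₑ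
      ≤ ∫⁻ s, ‖h s * (orthant n).indicator f (t - s)‖ₑ ∂orthantMeasure n :=
        enorm_integral_le_lintegral_enorm _
    _ ≤ ∫⁻ s, C * (box T).indicator (fun s => ‖f s‖ₑ) (t - s) ∂orthantMeasure n :=
        lintegral_mono_ae ((ae_orthantMeasure_mem n).mono key)
    _ ≤ ∫⁻ s, C * (box T).indicator (fun s => ‖f s‖ₑ) (t - s) := setLIntegral_le_lintegral _ _
    _ = C * boxNorm T f := by
        rw [lintegral_const_mul' _ _ hC,
          lintegral_sub_left_eq_self ((box T).indicator fun s => ‖f s‖ₑ) t,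
          lintegral_indicator (measurableSet_box T), boxNorm, eLpNorm_one_eq_lintegral_enorm]

theorem edist_orthantConv_le {T t : Fin n → ℝ} (ht : t ∈ box T) {h : (Fin n → ℝ) → ℝ} {C : ℝ≥0∞}
    (hC : C ≠ ∞) (hh : ∀ s ∈ box T, ‖h s‖ₑ ≤ C) {f g : (Fin n → ℝ) → ℝ}
    (hf : Integrable (fun s => h s * (orthant n).indicator f (t - s)) (orthantMeasure n))
    (hg : Integrable (fun s => h s * (orthant n).indicator g (t - s)) (orthantMeasure n)) :
    edist (orthantConv (orthantMeasure n) h f t) (orthantConv (orthantMeasure n) h g t) ≤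
      C * boxNorm T (f - g) := by
  refine le_trans (le_of_eq ?_) (enorm_orthantConv_le ht hC hh (f - g))
  rw [edist_eq_enorm_sub, orthantConv, orthantConv, orthantConv, ← integral_sub hf hg]
  congr 2
  funext s
  rw [Set.indicator_sub', Pi.sub_apply, mul_sub]

/-- Bounded continuous functions are dense in `L¹`, and Stone-Weierstrass approximates them
uniformly by polynomials on the compact `[0,T]`. -/
theorem exists_mvPolynomial_boxNorm_sub_lt {T : Fin n → ℝ} {f : (Fin n → ℝ) → ℝ}
    (hf : Integrable f (volume.restrict (box T))) {ε : ℝ≥0∞} (hε : 0 < ε) :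
    ∃ p : MvPolynomial (Fin n) ℝ, boxNorm T ((fun s => MvPolynomial.eval s p) - f) < ε := by
  set K : Set (Fin n → ℝ) := Set.Icc 0 T
  have hKc : IsCompact K := isCompact_Icc
  have hbK : box T ⊆ K := fun s hs => ⟨fun i => (hs i trivial).1.le, fun i => (hs i trivial).2.le⟩
  have hvol : volume (box T) ≠ ∞ := ((measure_mono hbK).trans_lt hKc.measure_lt_top).ne
  obtain ⟨δ, hδ, hδε⟩ := ENNReal.lt_iff_exists_nnreal_btwn.1 (ENNReal.half_pos hε.ne')
  obtain ⟨φ, hφ, hφi⟩ := hf.exists_boundedContinuous_lintegral_sub_le hδ.ne'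
  -- A uniform error `η` costs at most `δ < ε / 2` in `L¹`; the `+ 1` in the denominator covers a
  -- box of volume zero.
  obtain ⟨η, hη, hηle⟩ : ∃ η : ℝ≥0, 0 < η ∧ η * volume (box T) ≤ δ := by
    lift volume (box T) to ℝ≥0 using hvol with v
    refine ⟨δ / (v + 1), div_pos (by exact_mod_cast hδ) (by positivity), ?_⟩
    norm_cast
    rw [div_mul_eq_mul_div, div_le_iff₀ (by positivity)]
    gcongr
    simp
  let A : Subalgebra ℝ C(Fin n → ℝ, ℝ) :=
    (MvPolynomial.aeval (R := ℝ) fun i => (⟨fun s => s i, continuous_apply i⟩ :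
      C(Fin n → ℝ, ℝ))).range
  have hA : A.SeparatesPoints := by
    intro s t hst
    obtain ⟨i, hi⟩ := Function.ne_iff.1 hst
    exact ⟨_, ⟨_, ⟨MvPolynomial.X i, rfl⟩, rfl⟩, by simpa using hi⟩
  obtain ⟨_, ⟨p, rfl⟩, hp⟩ :=
    ContinuousMap.exists_mem_subalgebra_near_continuous_of_isCompact_of_separatesPoints
      hA φ.toContinuousMap hKc (NNReal.coe_pos.2 hη)
  have heval : ∀ s, MvPolynomial.aeval (R := ℝ) (fun i => (⟨fun s => s i, continuous_apply i⟩ :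
      C(Fin n → ℝ, ℝ))) p s = MvPolynomial.eval s p := by
    clear hp
    intro s
    induction p using MvPolynomial.induction_on' with
    | monomial k c => simp [MvPolynomial.aeval_monomial, MvPolynomial.eval_monomial, Finsupp.prod]
    | add p q _ _ => simp_all
  refine ⟨p, ?_⟩
  rw [boxNorm, eLpNorm_one_eq_lintegral_enorm]
  calc ∫⁻ s in box T, ‖((fun s => MvPolynomial.eval s p) - f) s‖ₑ
      ≤ ∫⁻ s in box T, (η : ℝ≥0∞) + ‖f s - φ s‖ₑ := by
        refine setLIntegral_mono_ae' (measurableSet_box T) (ae_of_all _ fun s hs => ?_)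
        have h1 := hp s (hbK hs)
        have h2 : ‖MvPolynomial.eval s p - φ s‖ₑ ≤ η := by
          rw [← heval, enorm_le_coe, ← NNReal.coe_le_coe]
          exact h1.le
        refine le_trans ?_ (add_le_add_left h2 _)
        rw [← enorm_neg (f s - φ s)]
        refine le_trans (le_of_eq ?_) (enorm_add_le _ _)
        congr 1
        simp only [Pi.sub_apply]
        ring
    _ = η * volume (box T) + ∫⁻ s in box T, ‖f s - φ s‖ₑ := by
        rw [lintegral_add_left measurable_const, lintegral_const, Measure.restrict_apply_univ]
    _ ≤ δ + δ := add_le_add hηle hφ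
    _ < ε / 2 + ε / 2 := ENNReal.add_lt_add hδε hδε
    _ = ε := ENNReal.add_halves ε

end Box

/-! ### Extending the multiplier formula from polynomials to `𝓛`. -/

section Multiplier

variable {n : ℕ}

theorem isLaplaceTransformable_one : IsLaplaceTransformable fun _ : Fin n → ℝ => (1 : ℝ) := by
  intro x hx
  simpa using integrable_laplaceKernel hx

theorem coe_oneL : (oneL n : (Fin n → ℝ) → ℝ) =ᵐ[orthantMeasure n] fun _ => 1 :=
  AEEqFun.coeFn_const _ _

theorem laplace_one {x : Fin n → ℝ} (hx : x ∈ orthant n) :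
    laplace (fun _ => 1) x = ∏ i, (x i)⁻¹ := by
  simpa using laplace_monomial (fun _ => 0) hx

theorem ae_orthantMeasure_nonneg (n : ℕ) : ∀ᵐ s ∂orthantMeasure n, ∀ i, 0 ≤ s i :=
  (ae_orthantMeasure_mem n).mono fun _ hs i => (hs i).le

theorem laplace_orthantConv_orthantMeasure {h f : (Fin n → ℝ) → ℝ} (hh : IsLaplaceTransformable h)
    (hf : IsLaplaceTransformable f) {x : Fin n → ℝ} (hx : x ∈ orthant n) :
    laplace (orthantConv (orthantMeasure n) h f) x = laplace h x * laplace f x :=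
  laplace_orthantConv (ae_orthantMeasure_nonneg n) hh hf hx

/-- The iterated integral `∫_{(0,t)} f`, locally bounded. -/
theorem enorm_orthantConv_one_le {T t : Fin n → ℝ} (ht : t ∈ box T) (f : (Fin n → ℝ) → ℝ) :
    ‖orthantConv (orthantMeasure n) (fun _ => 1) f t‖ₑ ≤ boxNorm T f := by
  simpa using enorm_orthantConv_le (h := fun _ => 1) (C := 1) ht (by simp) (by simp) f

/-- Countably many cubes exhaust the orthant, so the null sets can be united. -/
theorem ae_of_forall_box {p : (Fin n → ℝ) → Prop}
    (h : ∀ T ∈ orthant n, ∀ᵐ t ∂orthantMeasure n, t ∈ box T → p t) :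
    ∀ᵐ t ∂orthantMeasure n, p t := by
  have h1 : ∀ᵐ t ∂orthantMeasure n, ∀ N : ℕ, t ∈ box (fun _ : Fin n => (N : ℝ) + 1) → p t :=
    ae_all_iff.2 fun N => h _ fun _ => by positivity
  filter_upwards [h1, ae_orthantMeasure_mem n] with t ht hto
  obtain ⟨N, hN⟩ := exists_nat_ge (∑ i, t i)
  refine ht N fun i _ => ⟨hto i, ?_⟩
  have := Finset.single_le_sum (fun j _ => (hto j).le) (Finset.mem_univ i)
  linarith

/-- A locally continuous operator acting on polynomials as a Laplace multiplier acts as such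
everywhere. -/
theorem laplace_apply_of_mvPolynomial {K : LaplaceSpace n →ₗ[ℝ] LaplaceSpace n}
    (hK : ∀ T ∈ orthant n, IsBoxContinuous T K)
    (hpoly : ∀ p : MvPolynomial (Fin n) ℝ, ∃ g : LaplaceSpace n,
      (g : (Fin n → ℝ) → ℝ) =ᵐ[orthantMeasure n] (fun s => MvPolynomial.eval s p) ∧
      ∀ x ∈ orthant n, laplace (K g) x = (∏ i, x i) * laplace (K (oneL n)) x * laplace g x)
    (f : LaplaceSpace n) {x : Fin n → ℝ} (hx : x ∈ orthant n) :
    laplace (K f) x = (∏ i, x i) * laplace (K (oneL n)) x * laplace f x := by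
  set ν := orthantMeasure n with hν
  -- Divided by `(∏ xᵢ)²`, the multiplier formula for `g` becomes the convolution identity `E * K g
  -- = H * g`. The extra integration makes `E` and `H` bounded on boxes, so both sides at a point of
  -- the box depend continuously on `K g` and `g` in `L¹(0,T)`.
  set E := orthantConv ν (fun _ => 1) (fun _ => 1) with hE
  set H := orthantConv ν (fun _ => 1) (K (oneL n)) with hH
  have hE' : IsLaplaceTransformable E :=
    isLaplaceTransformable_one.orthantConv isLaplaceTransformable_one
  have hH' : IsLaplaceTransformable H := (K (oneL n)).2.orthantConv isLaplaceTransformable_one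
  have hlE : ∀ x ∈ orthant n, laplace E x = (∏ i, (x i)⁻¹) * ∏ i, (x i)⁻¹ := fun x hx => by
    rw [hE, laplace_orthantConv_orthantMeasure isLaplaceTransformable_one
      isLaplaceTransformable_one hx, laplace_one hx]
  have hlH : ∀ x ∈ orthant n, laplace H x = (∏ i, (x i)⁻¹) * laplace (K (oneL n)) x :=
    fun x hx => by
      rw [hH, laplace_orthantConv_orthantMeasure isLaplaceTransformable_one (K (oneL n)).2 hx,
        laplace_one hx]
  have hp0 : ∀ x ∈ orthant n, ∏ i, x i ≠ 0 := fun x hx =>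
    (Finset.prod_pos fun i _ => hx i).ne'
  have hconv : ∀ g : LaplaceSpace n,
      (∀ x ∈ orthant n, laplace (K g) x = (∏ i, x i) * laplace (K (oneL n)) x * laplace g x) →
      orthantConv ν E (K g) =ᵐ[ν] orthantConv ν H g := fun g hg => by
    refine ae_eq_of_laplace_eq ((K g).2.orthantConv hE') (g.2.orthantConv hH') fun x hx => ?_
    rw [laplace_orthantConv_orthantMeasure hE' (K g).2 hx,
      laplace_orthantConv_orthantMeasure hH' g.2 hx, hlE x hx, hlH x hx, hg x hx,
      Finset.prod_inv_distrib]
    field_simp [hp0 x hx]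
  have hmain : orthantConv ν E (K f) =ᵐ[ν] orthantConv ν H f := by
    refine ae_of_forall_box fun T hT => ?_
    have hseq : ∀ m : ℕ, ∃ g : LaplaceSpace n, boxNorm T (g - f : LaplaceSpace n) < (m : ℝ≥0∞)⁻¹ ∧
        boxNorm T (K g - K f : LaplaceSpace n) < (m : ℝ≥0∞)⁻¹ ∧
        orthantConv ν E (K g) =ᵐ[ν] orthantConv ν H g := by
      intro m
      have hm : (0 : ℝ≥0∞) < (m : ℝ≥0∞)⁻¹ := by simp
      obtain ⟨δ, hδ, hKδ⟩ := hK T hT _ hm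
      obtain ⟨p, hp⟩ := exists_mvPolynomial_boxNorm_sub_lt
        (isLaplaceTransformable_coe f |>.integrable_box T) (lt_min hδ hm)
      obtain ⟨g, hg, hgK⟩ := hpoly p
      have h1 : boxNorm T (g - f : LaplaceSpace n) < min δ (m : ℝ≥0∞)⁻¹ := by
        rw [boxNorm_coe_sub]
        refine lt_of_eq_of_lt (boxNorm_congr_ae ?_) hp
        filter_upwards [hg] with s hs
        simp [hs]
      exact ⟨g, h1.trans_le (min_le_right _ _), hKδ _ _ (h1.trans_le (min_le_left _ _)),
        hconv g hgK⟩
    choose g hg hKg hgc using hseq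
    have hint : ∀ (h : (Fin n → ℝ) → ℝ) (f : LaplaceSpace n), IsLaplaceTransformable h →
        ∀ᵐ t ∂ν, Integrable (fun s => h s * (orthant n).indicator f (t - s)) ν :=
      fun h f hh => ae_restrict_of_ae (ae_integrable_orthantConv_integrand hh f.2)
    -- The approximants form a sequence, so one null set serves them all.
    filter_upwards [ae_all_iff.2 hgc, ae_all_iff.2 fun m => hint E (K (g m)) hE',
      ae_all_iff.2 fun m => hint H (g m) hH', hint E (K f) hE', hint H f hH']
      with t h1 h2 h3 h4 h5 ht
    set C₁ := boxNorm T fun _ => 1 with hC₁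
    set C₂ := boxNorm T (K (oneL n)) with hC₂
    have hC₁t : C₁ ≠ ∞ := isLaplaceTransformable_one.boxNorm_ne_top T
    have hC₂t : C₂ ≠ ∞ := (isLaplaceTransformable_coe (K (oneL n))).boxNorm_ne_top T
    have hle : ∀ m : ℕ, edist (orthantConv ν E (K f) t) (orthantConv ν H f t) ≤
        (C₁ + C₂) * (m : ℝ≥0∞)⁻¹ := fun m => by
      calc _ ≤ edist (orthantConv ν E (K (g m)) t) (orthantConv ν E (K f) t) +
            edist (orthantConv ν H (g m) t) (orthantConv ν H f t) := by
            rw [← h1 m, edist_comm (orthantConv ν E (K (g m)) t) (orthantConv ν E (K f) t)]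
            exact edist_triangle _ _ _
        _ ≤ C₁ * (m : ℝ≥0∞)⁻¹ + C₂ * (m : ℝ≥0∞)⁻¹ := by
            refine add_le_add ?_ ?_
            · refine (edist_orthantConv_le ht hC₁t
                (fun s hs => enorm_orthantConv_one_le hs _) (h2 m) h4).trans ?_
              rw [← boxNorm_coe_sub]
              gcongr
              exact (hKg m).le
            · refine (edist_orthantConv_le ht hC₂t
                (fun s hs => enorm_orthantConv_one_le hs _) (h3 m) h5).trans ?_
              rw [← boxNorm_coe_sub]
              gcongr
              exact (hg m).le
        _ = _ := (add_mul _ _ _).symm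
    have hlim : Tendsto (fun m : ℕ => (C₁ + C₂) * (m : ℝ≥0∞)⁻¹) atTop (𝓝 0) := by
      simpa using ENNReal.Tendsto.const_mul ENNReal.tendsto_inv_nat_nhds_zero
        (Or.inr (ENNReal.add_ne_top.2 ⟨hC₁t, hC₂t⟩))
    exact edist_eq_zero.1 (le_antisymm (ge_of_tendsto' hlim hle) (zero_le))
  have := congrFun (laplace_congr_ae hmain) x
  rw [laplace_orthantConv_orthantMeasure hE' (K f).2 hx,
    laplace_orthantConv_orthantMeasure hH' f.2 hx, hlE x hx, hlH x hx,
    Finset.prod_inv_distrib] at this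
  field_simp [hp0 x hx] at this
  linarith

end Multiplier

/-! ### Cauchy's functional equation on the cone `[0,∞)ⁿ`. -/

section Additive

/-- An additive function on the cone `[0,∞)ⁿ`, vanishing on the canonical basis and continuous
at a point of the open cone, vanishes. -/
theorem additive_eq_zero {n : ℕ} {l : (Fin n → ℝ≥0) → ℝ}
    (hadd : ∀ α β, l (α + β) = l α + l β) (hsingle : ∀ i, l (Pi.single i 1) = 0)
    {α₀ : Fin n → ℝ≥0} (h0 : ∀ i, 0 < α₀ i)
    (hc : ContinuousWithinAt l {α | ∀ i, 0 < α i} α₀) (β : Fin n → ℝ≥0) : l β = 0 := by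
  let L : (Fin n → ℝ≥0) →+ ℝ := AddMonoidHom.mk' l hadd
  have hnat : ∀ k : Fin n → ℕ, l (fun i => (k i : ℝ≥0)) = 0 := fun k => by
    have : (fun i => (k i : ℝ≥0)) = ∑ i, k i • (Pi.single i 1 : Fin n → ℝ≥0) := by
      ext j
      simp [Finset.sum_apply, Pi.single_apply]
    change L _ = 0
    rw [this, map_sum]
    exact Finset.sum_eq_zero fun i _ => by
      rw [map_nsmul]
      change k i • l _ = 0
      rw [hsingle, smul_zero]
  have hsmul : ∀ (N : ℕ) γ, l (N • γ) = N * l γ := fun N γ => by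
    have := map_nsmul L N γ
    exact this.trans (nsmul_eq_mul _ _)
  obtain ⟨δ, hδ, hball⟩ := Metric.continuousWithinAt_iff.1 hc 1 one_pos
  obtain ⟨M, hM⟩ := exists_nat_gt δ⁻¹
  have hM0 : (0 : ℝ) < M := (inv_pos.2 hδ).trans hM
  have hMn : (M : ℝ≥0) ≠ 0 := by
    have : M ≠ 0 := by rintro rfl; simp at hM0
    exact_mod_cast this
  -- As `1/M < δ`, the point `α₀ + γ/M` is within `δ` of `α₀`. Additivity cancels `l α₀` and leaves
  -- `|l (γ/M)| < 1`.
  have hbound : ∀ γ : Fin n → ℝ≥0, (∀ i, γ i ≤ 1) → |l γ| ≤ M := fun γ hγ => by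
    set η : Fin n → ℝ≥0 := fun i => γ i / M with hη
    have hγη : γ = M • η := by
      ext i
      simp only [hη, Pi.smul_apply, nsmul_eq_mul]
      rw [mul_div_cancel₀ _ hMn]
    have hd : dist (α₀ + η) α₀ < δ := by
      refine (dist_pi_lt_iff hδ).2 fun i => ?_
      rw [NNReal.dist_eq, Pi.add_apply, NNReal.coe_add, add_sub_cancel_left, NNReal.abs_eq]
      have h1 : (η i : ℝ) ≤ (M : ℝ)⁻¹ := by
        have : (γ i : ℝ) ≤ 1 := by exact_mod_cast hγ i
        simp only [hη, NNReal.coe_div, NNReal.coe_natCast]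
        rw [div_eq_mul_inv]
        exact mul_le_of_le_one_left (by positivity) this
      exact h1.trans_lt (inv_lt_of_inv_lt₀ hδ hM)
    have h1 := hball (x := α₀ + η) (fun i => add_pos_of_pos_of_nonneg (h0 i) (zero_le)) hd
    rw [hadd, Real.dist_eq, add_sub_cancel_left] at h1
    rw [hγη, hsmul, abs_mul, abs_of_pos hM0]
    exact mul_le_of_le_one_right hM0.le h1.le
  -- Split `N β` into its integer part, where `l` vanishes, and a remainder in the unit cube, where
  -- `l` is bounded by `M` independently of `N`.
  have hN : ∀ N : ℕ, N * |l β| ≤ M := fun N => by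
    set k : Fin n → ℕ := fun i => ⌊N * β i⌋₊
    have hk : N • β = (fun i => (k i : ℝ≥0)) + fun i => N * β i - k i := by
      ext i
      have : (k i : ℝ≥0) ≤ N * β i := Nat.floor_le (zero_le)
      simp only [Pi.smul_apply, nsmul_eq_mul, Pi.add_apply]
      rw [add_tsub_cancel_of_le this]
    have h1 : l (N • β) = l fun i => N * β i - k i := by rw [hk, hadd, hnat, zero_add]
    rw [← Nat.abs_cast N, ← abs_mul, ← hsmul, h1]
    refine hbound _ fun i => ?_
    rw [tsub_le_iff_left]
    exact (Nat.lt_floor_add_one _).le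
  by_contra hne
  obtain ⟨N, hN'⟩ := exists_nat_gt (M / |l β|)
  have := hN N
  rw [div_lt_iff₀ (abs_pos.2 hne)] at hN'
  linarith

end Additive

/-! ### Consequences of the identity and index laws. -/

section Family

variable {n : ℕ}

theorem laplace_coe_add (f g : LaplaceSpace n) {x : Fin n → ℝ} (hx : x ∈ orthant n) :
    laplace (f + g : LaplaceSpace n) x = laplace f x + laplace g x := by
  rw [laplace, laplace, laplace, ← integral_add (f.2 x hx) (g.2 x hx)]
  refine integral_congr_ae ?_
  filter_upwards [AEEqFun.coeFn_add f.1 g.1] with s hs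
  rw [Submodule.coe_add, hs, Pi.add_apply, add_mul]

theorem laplace_coe_smul (c : ℝ) (f : LaplaceSpace n) (x : Fin n → ℝ) :
    laplace (c • f : LaplaceSpace n) x = c * laplace f x := by
  rw [laplace, laplace, ← integral_const_mul]
  refine integral_congr_ae ?_
  filter_upwards [AEEqFun.coeFn_smul c f.1] with s hs
  rw [Submodule.coe_smul, hs, Pi.smul_apply, smul_eq_mul, mul_assoc]

theorem laplace_oneL {x : Fin n → ℝ} (hx : x ∈ orthant n) :
    laplace (oneL n) x = (∏ i, x i)⁻¹ := by
  rw [laplace_congr_ae coe_oneL, laplace_one hx, Finset.prod_inv_distrib]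

/-- The Laplace multiplier `∏ᵢ xᵢ^{-αᵢ}` of the Riemann-Liouville integral. -/
noncomputable def rlMultiplier (x : Fin n → ℝ) (α : Fin n → ℝ≥0) : ℝ := ∏ i, x i ^ (-(α i : ℝ))

theorem rlMultiplier_pos {x : Fin n → ℝ} (hx : x ∈ orthant n) (α : Fin n → ℝ≥0) :
    0 < rlMultiplier x α :=
  Finset.prod_pos fun i _ => Real.rpow_pos_of_pos (hx i) _

theorem rlMultiplier_add {x : Fin n → ℝ} (hx : x ∈ orthant n) (α β : Fin n → ℝ≥0) :
    rlMultiplier x (α + β) = rlMultiplier x α * rlMultiplier x β := by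
  rw [rlMultiplier, rlMultiplier, rlMultiplier, ← Finset.prod_mul_distrib]
  refine Finset.prod_congr rfl fun i _ => ?_
  rw [← Real.rpow_add (hx i), Pi.add_apply, NNReal.coe_add, neg_add]

theorem continuous_rlMultiplier {x : Fin n → ℝ} (hx : x ∈ orthant n) :
    Continuous (rlMultiplier x) := by
  refine continuous_finsetProd _ fun i _ => ?_
  refine Continuous.rpow continuous_const ?_ fun _ => Or.inl (hx i).ne'
  fun_prop

theorem rlMultiplier_natCast (x : Fin n → ℝ) (k : Fin n → ℕ) :
    rlMultiplier x (fun i => (k i : ℝ≥0)) = ∏ i, (x i)⁻¹ ^ k i := by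
  refine Finset.prod_congr rfl fun i _ => ?_
  rw [NNReal.coe_natCast, inv_pow, ← zpow_natCast, ← zpow_neg, ← Real.rpow_intCast]
  norm_cast

variable {J : (Fin n → ℝ≥0) → (LaplaceSpace n →ₗ[ℝ] LaplaceSpace n)}

theorem laplace_apply_single
    (hident : ∀ (i : Fin n) (f : LaplaceSpace n),
      (J (Pi.single i 1) f : (Fin n → ℝ) → ℝ) =ᵐ[orthantMeasure n]
        rlIntegral (Pi.single i 1) f)
    (i : Fin n) (f : LaplaceSpace n) {x : Fin n → ℝ} (hx : x ∈ orthant n) :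
    laplace (J (Pi.single i 1) f) x = rlMultiplier x (Pi.single i 1) * laplace f x := by
  rw [laplace_congr_ae (hident i f), laplace_rlIntegral _ f.2 hx, rlMultiplier]

theorem laplace_apply_natCast (hn : 1 ≤ n)
    (hident : ∀ (i : Fin n) (f : LaplaceSpace n),
      (J (Pi.single i 1) f : (Fin n → ℝ) → ℝ) =ᵐ[orthantMeasure n]
        rlIntegral (Pi.single i 1) f)
    (hindex : ∀ α β : Fin n → ℝ≥0, J (α + β) = J α ∘ₗ J β)
    (k : Fin n → ℕ) (f : LaplaceSpace n) {x : Fin n → ℝ} (hx : x ∈ orthant n) :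
    laplace (J (fun i => (k i : ℝ≥0)) f) x =
      rlMultiplier x (fun i => (k i : ℝ≥0)) * laplace f x := by
  let S : AddSubmonoid (Fin n → ℝ≥0) :=
    { carrier := {β | ∀ f : LaplaceSpace n, laplace (J β f) x = rlMultiplier x β * laplace f x}
      add_mem' := by
        intro α β hα hβ f
        rw [hindex, LinearMap.comp_apply, hα, hβ, rlMultiplier_add hx, mul_assoc]
      -- `J^{e₁} J^0 = J^{e₁}`, and the multiplier of `J^{e₁}` can be cancelled. A basis vector is
      -- needed here, whence `1 ≤ n`.
      zero_mem' := by
        intro f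
        have h1 := laplace_apply_single hident ⟨0, hn⟩ (J 0 f) hx
        rw [← LinearMap.comp_apply, ← hindex, add_zero, laplace_apply_single hident _ f hx] at h1
        have h2 := mul_left_cancel₀ (rlMultiplier_pos hx _).ne' h1
        simp [← h2, rlMultiplier] }
  have hmem : (fun i => (k i : ℝ≥0)) ∈ S := by
    have : (fun i => (k i : ℝ≥0)) = ∑ i, k i • (Pi.single i 1 : Fin n → ℝ≥0) := by
      ext j
      simp [Finset.sum_apply, Pi.single_apply]
    rw [this]
    exact S.sum_mem fun i _ => S.nsmul_mem (fun f => laplace_apply_single hident i f hx) _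
  exact hmem f

/-- The monomial `s^k` is `k! J^k 1`, so the index law gives `J^α s^k = k! J^k (J^α 1)`, where the
multiplier of `J^k` is known. -/
theorem exists_coe_eq_mvPolynomial (hn : 1 ≤ n)
    (hident : ∀ (i : Fin n) (f : LaplaceSpace n),
      (J (Pi.single i 1) f : (Fin n → ℝ) → ℝ) =ᵐ[orthantMeasure n]
        rlIntegral (Pi.single i 1) f)
    (hindex : ∀ α β : Fin n → ℝ≥0, J (α + β) = J α ∘ₗ J β)
    (α : Fin n → ℝ≥0) (p : MvPolynomial (Fin n) ℝ) :
    ∃ g : LaplaceSpace n,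
      (g : (Fin n → ℝ) → ℝ) =ᵐ[orthantMeasure n] (fun s => MvPolynomial.eval s p) ∧
      ∀ x ∈ orthant n,
        laplace (J α g) x = (∏ i, x i) * laplace (J α (oneL n)) x * laplace g x := by
  induction p using MvPolynomial.induction_on' with
  | monomial k c =>
    have hmul := fun (f : LaplaceSpace n) {x} (hx : x ∈ orthant n) =>
      laplace_apply_natCast hn hident hindex k f hx
    set κ : Fin n → ℝ≥0 := fun i => (k i : ℝ≥0) with hκ
    set F : ℝ := ∏ i, ((k i).factorial : ℝ) with hF
    have h1 : (F • J κ (oneL n) : LaplaceSpace n) =ᵐ[orthantMeasure n]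
        fun s => ∏ i, s i ^ k i := by
      refine ae_eq_of_laplace_eq (F • J κ (oneL n)).2 (isLaplaceTransformable_monomial k)
        fun x hx => ?_
      rw [laplace_coe_smul, hmul _ hx, laplace_oneL hx, laplace_monomial _ hx,
        rlMultiplier_natCast, ← Finset.prod_inv_distrib, ← Finset.prod_mul_distrib,
        ← Finset.prod_mul_distrib]
      simp only [pow_succ]
    refine ⟨c • F • J κ (oneL n), ?_, fun x hx => ?_⟩
    · filter_upwards [h1, AEEqFun.coeFn_smul c (F • J κ (oneL n)).1] with s hs hs'
      rw [Submodule.coe_smul, hs', Pi.smul_apply, hs, MvPolynomial.eval_monomial,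
        Finsupp.prod_fintype _ _ (by simp), smul_eq_mul]
    · rw [map_smul, map_smul, laplace_coe_smul, laplace_coe_smul, laplace_coe_smul,
        laplace_coe_smul, ← LinearMap.comp_apply, ← hindex, add_comm, hindex,
        LinearMap.comp_apply, hmul _ hx, hmul _ hx, laplace_oneL hx]
      have : ∏ i, x i ≠ 0 := (Finset.prod_pos fun i _ => hx i).ne'
      field_simp
  | add p q hp hq =>
    obtain ⟨g, hg, hg'⟩ := hp
    obtain ⟨h, hh, hh'⟩ := hq
    refine ⟨g + h, ?_, fun x hx => ?_⟩
    · filter_upwards [hg, hh, AEEqFun.coeFn_add g.1 h.1] with s h1 h2 h3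
      rw [Submodule.coe_add, h3, Pi.add_apply, h1, h2, map_add]
    · rw [map_add, laplace_coe_add _ _ hx, laplace_coe_add _ _ hx, hg' x hx, hh' x hx, mul_add]

/-- A multiplicative function on the cone `[0,∞)ⁿ` that is nonzero at integer points is
positive. -/
theorem multiplicative_pos {φ : (Fin n → ℝ≥0) → ℝ} (hmul : ∀ α β, φ (α + β) = φ α * φ β)
    (hnat : ∀ k : Fin n → ℕ, φ (fun i => (k i : ℝ≥0)) ≠ 0) (α : Fin n → ℝ≥0) : 0 < φ α := by
  have hne : φ α ≠ 0 := fun h => by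
    -- A zero at `α` would propagate to the integer point `⌈α⌉`, which exceeds `α` by an element of
    -- the cone.
    refine hnat (fun i => ⌈α i⌉₊) ?_
    have : (fun i => ((⌈α i⌉₊ : ℕ) : ℝ≥0)) = α + fun i => ((⌈α i⌉₊ : ℕ) : ℝ≥0) - α i := by
      ext i
      rw [Pi.add_apply, add_tsub_cancel_of_le (Nat.le_ceil _)]
    rw [this, hmul, h, zero_mul]
  -- Halving `α` exhibits `φ α` as a square.
  have h2 : φ α = φ (fun i => α i / 2) * φ (fun i => α i / 2) := by
    rw [← hmul]
    congr 1
    ext i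
    simp
  exact lt_of_le_of_ne (h2 ▸ mul_self_nonneg _) hne.symm

end Family

end FracCalc

/-! ### Identification of the multiplier. -/

open FracCalc
theorem mainTheorem8 (n : ℕ) (hn : 1 ≤ n)
    (J : (Fin n → ℝ≥0) → (LaplaceSpace n →ₗ[ℝ] LaplaceSpace n))
    (hcont : ∀ α : Fin n → ℝ≥0, ∀ T ∈ orthant n, IsBoxContinuous T (J α))
    (hident : ∀ (i : Fin n) (f : LaplaceSpace n),
      (J (Pi.single i 1) f : (Fin n → ℝ) → ℝ) =ᵐ[orthantMeasure n]
        rlIntegral (Pi.single i 1) f)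
    (hindex : ∀ α β : Fin n → ℝ≥0, J (α + β) = J α ∘ₗ J β)
    (hpoint : ∀ x ∈ orthant n, ∃ α₀ : Fin n → ℝ≥0, (∀ i, 0 < α₀ i) ∧
      ContinuousWithinAt (fun α => laplace (J α (oneL n)) x) {α | ∀ i, 0 < α i} α₀) :
    ∀ (α : Fin n → ℝ≥0) (f : LaplaceSpace n),
      (J α f : (Fin n → ℝ) → ℝ) =ᵐ[orthantMeasure n] rlIntegral α f := by
  intro α f
  refine ae_eq_of_laplace_eq (J α f).2 (IsLaplaceTransformable.rlIntegral α f.2) fun x hx => ?_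
  have hJ : ∀ (α : Fin n → ℝ≥0) (f : LaplaceSpace n),
      laplace (J α f) x = (∏ i, x i) * laplace (J α (oneL n)) x * laplace f x := fun α f =>
    laplace_apply_of_mvPolynomial (hcont α)
      (exists_coe_eq_mvPolynomial hn hident hindex α) f hx
  have hp : 0 < ∏ i, x i := Finset.prod_pos fun i _ => hx i
  -- Since the transform of `1` is `1 / ∏ xᵢ`, this is the factor by which `J^α` multiplies
  -- transforms at the fixed point `x`.
  set φ : (Fin n → ℝ≥0) → ℝ := fun α => (∏ i, x i) * laplace (J α (oneL n)) x with hφ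
  have hmul : ∀ α β, φ (α + β) = φ α * φ β := fun α β => by
    simp only [hφ]
    rw [hindex, LinearMap.comp_apply, hJ]
    ring
  have hnat : ∀ k : Fin n → ℕ,
      φ (fun i => (k i : ℝ≥0)) = rlMultiplier x fun i => (k i : ℝ≥0) := fun k => by
    simp only [hφ]
    rw [laplace_apply_natCast hn hident hindex k _ hx, laplace_oneL hx]
    field_simp
  have hpos : ∀ α, 0 < φ α := multiplicative_pos hmul fun k => by
    rw [hnat]
    exact (rlMultiplier_pos hx _).ne'
  have hψ := rlMultiplier_pos hx
  obtain ⟨α₀, h0, hc⟩ := hpoint x hx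
  -- Positivity of both multipliers turns their ratio into an additive function of the order, to
  -- which the single continuity point for this `x` applies.
  have hl := additive_eq_zero (l := fun α => Real.log (φ α / rlMultiplier x α))
    (fun α β => by
      rw [← Real.log_mul (div_pos (hpos α) (hψ α)).ne' (div_pos (hpos β) (hψ β)).ne', hmul,
        rlMultiplier_add hx, mul_div_mul_comm])
    (fun i => by
      simp only [hφ]
      rw [laplace_apply_single hident i _ hx, laplace_oneL hx]
      have := hψ (Pi.single i 1)
      field_simp
      simp)
    h0
    (((continuousWithinAt_const.mul hc).div (continuous_rlMultiplier hx).continuousWithinAt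
      (hψ α₀).ne').log (div_pos (hpos α₀) (hψ α₀)).ne') α
  have h1 := Real.eq_one_of_pos_of_log_eq_zero (div_pos (hpos α) (hψ α)) hl
  rw [div_eq_one_iff_eq (hψ α).ne'] at h1
  rw [hJ, laplace_rlIntegral α f.2 hx]
  change φ α * _ = rlMultiplier x α * _
  rw [h1]
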